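/- Let $\gamma\in\mathbb R$, $\gamma\neq 0$, and for $n\in\mathbb N$ consider the Dirichlet–Neumann modes on $(0,\pi)$ $$\phi_j=\sqrt{\tfrac2\pi}\,\tfrac1j\sin jx,\qquad \psi_j=\sqrt{\tfrac2\pi}\sin jx,\qquad \xi_j=\sqrt{\tfrac2\pi}\cos jx,\qquad j=1,\dots,n .$$ Let $\mathcal H=L^2(0,\pi)^3$ (complex scalars) with elements $z=(\partial_x u,v,\theta)$ and norm $\|z\|^2=\|\partial_xu\|_{L^2}^2+\|v\|_{L^2}^2+\|\theta\|_{L^2}^2$, and let $\mathcal H_n\subset\mathcal H$, with the induced norm, be the span of the $3n$ orthonormal vectors $E_j=(\phi_j',0,0)$, $E_{n+j}=(0,\psi_j,0)$, $E_{2n+j}=(0,0,\xi_j)$, $1\le j\le n$. Let $\mathcal W_n$ be the linear operator on $\mathcal H_n$ whose matrix in the basis $E_1,\dots,E_{3n}$ is $$\begin{pmatrix}0&D_n&0\\-D_n&0&\gamma D_n\\0&-\gamma D_n&-D_n^2\end{pmatrix},\qquad D_n=\operatorname{diag}(1,\dots,n),$$ and let $T_n(t)=e^{t\mathcal W_n}$.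 Then for every $n$, $(T_n(t))_{t\ge0}$ is a $C_0$-semigroup of contractions on $\mathcal H_n$ with generator $\mathcal W_n$, and $i\mathbb R\subset\rho(\mathcal W_n)$ (in particular $\mathcal W_n$ is invertible). The semigroups are uniformly polynomially stable of order $2$: there is a constant $M>0$, independent of $n$ and $t$ (it may depend on $\gamma$), such that $$\|T_n(t)\mathcal W_n^{-1}\|_{\mathcal L(\mathcal H_n)}\le \frac{M}{t^{1/2}}\qquad\text{for all } t>0 \text{ and all } n\in\mathbb N .$$ Moreover $$\sup_{|\beta|\ge1,\ n\in\mathbb N}\ \frac1{|\beta|^{2}}\,\bigl\|(i\beta I-\mathcal W_n)^{-1}\bigr\|_{\mathcal L(\mathcal H_n)}<\infty ,$$ where $\beta$ ranges over the real numbers. -/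

import Mathlib

open MeasureTheory Matrix

noncomputable section

namespace Thermo

/-! ### Semigroups on normed spaces -/

/-- `T` is a `C₀`-semigroup of contractions on `E` (only the values `T t` with `t ≥ 0` matter). -/
structure IsContractionSemigroup {E : Type*} [NormedAddCommGroup E] [NormedSpace ℂ E]
    (T : ℝ → E →L[ℂ] E) : Prop where
  map_zero : T 0 = 1
  map_add : ∀ s t : ℝ, 0 ≤ s → 0 ≤ t → T (s + t) = T s * T t
  continuousOn : ∀ z : E, ContinuousOn (fun t => T t z) (Set.Ici 0)
  contraction : ∀ t : ℝ, 0 ≤ t → ‖T t‖ ≤ 1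

/-- The bounded operator `A` is the infinitesimal generator of `T`:
`(T t z - z) / t → A z` as `t → 0+`, for every `z`. -/
def IsGenerator {E : Type*} [NormedAddCommGroup E] [NormedSpace ℂ E]
    (T : ℝ → E →L[ℂ] E) (A : E →L[ℂ] E) : Prop :=
  ∀ z : E, HasDerivWithinAt (fun t => T t z) (A z) (Set.Ici 0) 0

/-- Uniform polynomial stability of order `α` of a sequence of semigroups `T n` with (bounded)
generators `A n`: every `A n` is invertible and `‖T n t (A n)⁻¹‖ ≤ M / t ^ (1 / α)` for all
`t > 0` and all `n`, with `M` independent of `n`.  `Ring.inverse` is the genuine inverse of an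
invertible operator. -/
def UniformlyPolynomiallyStable {H : ℕ → Type*} [∀ n, NormedAddCommGroup (H n)]
    [∀ n, NormedSpace ℂ (H n)] (T : ∀ n, ℝ → H n →L[ℂ] H n) (A : ∀ n, H n →L[ℂ] H n)
    (α : ℝ) : Prop :=
  (∀ n, IsUnit (A n)) ∧
    ∃ M : ℝ, 0 < M ∧ ∀ (n : ℕ) (t : ℝ), 0 < t →
      ‖T n t * Ring.inverse (A n)‖ ≤ M / t ^ (1 / α)

/-! ### The modes and the modal spaces -/

/-- Displacement modes `φ_j(x) = √(2/π) (1/j) sin (j x)`. -/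
def phi (j : ℕ) (x : ℝ) : ℝ := √(2 / Real.pi) * (1 / (j : ℝ)) * Real.sin (j * x)

/-- Velocity modes `ψ_j(x) = √(2/π) sin (j x)`. -/
def psi (j : ℕ) (x : ℝ) : ℝ := √(2 / Real.pi) * Real.sin (j * x)

/-- Temperature modes `ξ_j(x) = √(2/π) cos (j x)`. -/
def xi (j : ℕ) (x : ℝ) : ℝ := √(2 / Real.pi) * Real.cos (j * x)

/-- Lebesgue measure on the rod `(0, π)`. -/
abbrev rod : Measure ℝ := volume.restrict (Set.Ioo 0 Real.pi)

/-- The energy space `L²(0,π) × L²(0,π) × L²(0,π)` with the Hilbert norm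
`‖z‖² = ‖∂ₓu‖² + ‖v‖² + ‖θ‖²` for `z = (∂ₓu, v, θ)` (complex scalars). -/
abbrev EnergySpace : Type := PiLp 2 (fun _ : Fin 3 => Lp ℂ 2 rod)

/-- The function that the `j`-th mode contributes to the component `k` of `(∂ₓu, v, θ)`. -/
def modeFun (k : Fin 3) (j : ℕ) : ℝ → ℝ := ![deriv (phi j), psi j, xi j] k

theorem deriv_phi {j : ℕ} (hj : j ≠ 0) : deriv (phi j) = xi j := by
  funext x
  have h1 : HasDerivAt (fun x : ℝ => (j : ℝ) * x) (j : ℝ) x := by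
    simpa using (hasDerivAt_id x).const_mul (j : ℝ)
  have h2 := (h1.sin).const_mul (√(2 / Real.pi) * (1 / (j : ℝ)))
  have h3 : deriv (phi j) x = _ := h2.deriv
  have hj' : (j : ℝ) ≠ 0 := by exact_mod_cast hj
  rw [h3, xi]
  field_simp

theorem modeFun_memLp (k : Fin 3) (j : ℕ) (hj : j ≠ 0) :
    MemLp (fun x => (modeFun k j x : ℂ)) 2 rod := by
  have hs : Continuous (psi j) := by unfold psi; fun_prop
  have hc : Continuous (xi j) := by unfold xi; fun_prop
  have hb : ∀ y : ℝ, |y| ≤ 1 → ‖((√(2 / Real.pi) * y : ℝ) : ℂ)‖ ≤ √(2 / Real.pi) := by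
    intro y hy
    rw [Complex.norm_real, Real.norm_eq_abs, abs_mul, abs_of_nonneg (Real.sqrt_nonneg _)]
    exact mul_le_of_le_one_right (Real.sqrt_nonneg _) hy
  have hS : MemLp (fun x => (psi j x : ℂ)) 2 rod :=
    MemLp.of_bound (by fun_prop) (√(2 / Real.pi))
      (Filter.Eventually.of_forall fun x => hb _ (Real.abs_sin_le_one _))
  have hC : MemLp (fun x => (xi j x : ℂ)) 2 rod :=
    MemLp.of_bound (by fun_prop) (√(2 / Real.pi))
      (Filter.Eventually.of_forall fun x => hb _ (Real.abs_cos_le_one _))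
  fin_cases k
  · simpa [modeFun, deriv_phi hj] using hC
  · simpa [modeFun] using hS
  · simpa [modeFun] using hC

/-- `modeLp k j` is the mode number `j + 1` (`j = 0, 1, …`) of the component `k`, in `L²(0,π)`. -/
def modeLp (k : Fin 3) (j : ℕ) : Lp ℂ 2 rod := (modeFun_memLp k (j + 1) j.succ_ne_zero).toLp _

/-- The basis vectors `E_j = (∂ₓφ_j, 0, 0)`, `E_{n+j} = (0, ψ_j, 0)`, `E_{2n+j} = (0, 0, ξ_j)`,
`1 ≤ j ≤ n`, indexed by `(component, j - 1)`. -/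
def modeVec (n : ℕ) (p : Fin 3 × Fin n) : EnergySpace :=
  WithLp.toLp 2 (Pi.single p.1 (modeLp p.1 p.2))

/-- The modal space `H_n = span {E_1, …, E_{3n}}`, with the norm induced by the energy space. -/
def ModalSpace (n : ℕ) : Type :=
  ↥(Submodule.span ℂ (Set.range (modeVec n)))

instance (n : ℕ) : NormedAddCommGroup (ModalSpace n) :=
  inferInstanceAs (NormedAddCommGroup ↥(Submodule.span ℂ (Set.range (modeVec n))))

instance (n : ℕ) : InnerProductSpace ℂ (ModalSpace n) :=
  inferInstanceAs (InnerProductSpace ℂ ↥(Submodule.span ℂ (Set.range (modeVec n))))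

instance (n : ℕ) : FiniteDimensional ℂ (ModalSpace n) :=
  FiniteDimensional.span_of_finite ℂ (Set.finite_range (modeVec n))

theorem integral_cos_nat (m : ℤ) (hm : m ≠ 0) :
    ∫ x in (0 : ℝ)..Real.pi, Real.cos (m * x) = 0 := by
  have hm' : (m : ℝ) ≠ 0 := by exact_mod_cast hm
  rw [intervalIntegral.integral_comp_mul_left (f := Real.cos) hm']
  simp

theorem integral_cos_cos (i j : ℕ) :
    ∫ x in (0 : ℝ)..Real.pi, Real.cos ((i + 1 : ℕ) * x) * Real.cos ((j + 1 : ℕ) * x)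
      = if i = j then Real.pi / 2 else 0 := by
  have h : ∀ x : ℝ, Real.cos ((i + 1 : ℕ) * x) * Real.cos ((j + 1 : ℕ) * x)
      = (Real.cos (((i - j : ℤ) : ℝ) * x) + Real.cos (((i + j + 2 : ℤ) : ℝ) * x)) / 2 := by
    intro x
    have e1 : ((i - j : ℤ) : ℝ) * x = (i + 1 : ℕ) * x - (j + 1 : ℕ) * x := by push_cast; ring
    have e2 : ((i + j + 2 : ℤ) : ℝ) * x = (i + 1 : ℕ) * x + (j + 1 : ℕ) * x := by push_cast; ring
    rw [e1, e2, Real.cos_sub, Real.cos_add]; ring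
  simp_rw [h]
  rw [intervalIntegral.integral_div, intervalIntegral.integral_add
    (by apply Continuous.intervalIntegrable; fun_prop)
    (by apply Continuous.intervalIntegrable; fun_prop), integral_cos_nat (i + j + 2) (by omega)]
  split_ifs with hij
  · subst hij; simp
  · rw [integral_cos_nat (i - j) (by omega)]; simp

theorem integral_sin_sin (i j : ℕ) :
    ∫ x in (0 : ℝ)..Real.pi, Real.sin ((i + 1 : ℕ) * x) * Real.sin ((j + 1 : ℕ) * x)
      = if i = j then Real.pi / 2 else 0 := by
  have h : ∀ x : ℝ, Real.sin ((i + 1 : ℕ) * x) * Real.sin ((j + 1 : ℕ) * x)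
      = (Real.cos (((i - j : ℤ) : ℝ) * x) - Real.cos (((i + j + 2 : ℤ) : ℝ) * x)) / 2 := by
    intro x
    have e1 : ((i - j : ℤ) : ℝ) * x = (i + 1 : ℕ) * x - (j + 1 : ℕ) * x := by push_cast; ring
    have e2 : ((i + j + 2 : ℤ) : ℝ) * x = (i + 1 : ℕ) * x + (j + 1 : ℕ) * x := by push_cast; ring
    rw [e1, e2, Real.cos_sub, Real.cos_add]; ring
  simp_rw [h]
  rw [intervalIntegral.integral_div, intervalIntegral.integral_sub
    (by apply Continuous.intervalIntegrable; fun_prop)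
    (by apply Continuous.intervalIntegrable; fun_prop), integral_cos_nat (i + j + 2) (by omega)]
  split_ifs with hij
  · subst hij; simp
  · rw [integral_cos_nat _ (by omega)]; simp

theorem integral_modeFun (k : Fin 3) (i j : ℕ) :
    ∫ x in (0 : ℝ)..Real.pi, modeFun k (i + 1) x * modeFun k (j + 1) x
      = if i = j then 1 else 0 := by
  have hpi := Real.pi_pos
  have hsq : √(2 / Real.pi) * √(2 / Real.pi) = 2 / Real.pi :=
    Real.mul_self_sqrt (by positivity)
  have hS : ∫ x in (0 : ℝ)..Real.pi, psi (i + 1) x * psi (j + 1) x = if i = j then 1 else 0 := by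
    have : ∀ x, psi (i + 1) x * psi (j + 1) x
        = 2 / Real.pi * (Real.sin ((i + 1 : ℕ) * x) * Real.sin ((j + 1 : ℕ) * x)) := by
      intro x; rw [← hsq]; unfold psi; ring
    simp_rw [this]
    rw [intervalIntegral.integral_const_mul, integral_sin_sin]
    split_ifs <;> (field_simp; try simp)
  have hC : ∫ x in (0 : ℝ)..Real.pi, xi (i + 1) x * xi (j + 1) x = if i = j then 1 else 0 := by
    have : ∀ x, xi (i + 1) x * xi (j + 1) x
        = 2 / Real.pi * (Real.cos ((i + 1 : ℕ) * x) * Real.cos ((j + 1 : ℕ) * x)) := by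
      intro x; rw [← hsq]; unfold xi; ring
    simp_rw [this]
    rw [intervalIntegral.integral_const_mul, integral_cos_cos]
    split_ifs <;> (field_simp; try simp)
  fin_cases k
  · simpa [modeFun, deriv_phi] using hC
  · simpa [modeFun] using hS
  · simpa [modeFun] using hC

theorem inner_modeLp (k : Fin 3) (i j : ℕ) :
    inner ℂ (modeLp k i) (modeLp k j) = if i = j then 1 else 0 := by
  have hi := (modeFun_memLp k (i + 1) i.succ_ne_zero).coeFn_toLp
  have hj := (modeFun_memLp k (j + 1) j.succ_ne_zero).coeFn_toLp
  rw [L2.inner_def]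
  have h : ∫ a, inner ℂ ((modeLp k i : ℝ → ℂ) a) ((modeLp k j : ℝ → ℂ) a) ∂rod
      = ∫ a, ((modeFun k (i + 1) a * modeFun k (j + 1) a : ℝ) : ℂ) ∂rod := by
    apply integral_congr_ae
    filter_upwards [hi, hj] with a ha hb
    unfold modeLp
    rw [ha, hb]
    simp [mul_comm]
  rw [h, integral_complex_ofReal, ← integral_Ioc_eq_integral_Ioo,
    ← intervalIntegral.integral_of_le Real.pi_pos.le, integral_modeFun]
  split_ifs <;> simp

/-- The basis vectors are orthonormal. -/
theorem orthonormal_modeVec (n : ℕ) : Orthonormal ℂ (modeVec n) := by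
  rw [orthonormal_iff_ite]
  rintro ⟨k, i⟩ ⟨l, j⟩
  rw [PiLp.inner_apply]
  by_cases hkl : k = l
  · subst hkl
    rw [Finset.sum_eq_single k]
    · simp [modeVec, inner_modeLp, Fin.ext_iff]
    · intro b _ hb
      simp [modeVec, hb]
    · simp
  · rw [if_neg (by simp [hkl])]
    apply Finset.sum_eq_zero
    intro b _
    by_cases hb : b = k
    · subst hb
      simp [modeVec, hkl]
    · simp [modeVec, hb]

/-- The modes as a basis of the modal space. -/
def modalBasis (n : ℕ) : Module.Basis (Fin 3 × Fin n) ℂ (ModalSpace n) :=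
  Module.Basis.span (orthonormal_modeVec n).linearIndependent

/-! ### The modal approximations -/

/-- `D_n = diag(1, …, n)`. -/
def Dmat (n : ℕ) : Matrix (Fin n) (Fin n) ℂ := Matrix.diagonal fun j => ((j : ℕ) : ℂ) + 1

/-- The `3n × 3n` block matrix `W_n` of the modal approximation. -/
def Wmat (γ : ℝ) (n : ℕ) : Matrix (Fin 3 × Fin n) (Fin 3 × Fin n) ℂ :=
  Matrix.comp (Fin 3) (Fin 3) (Fin n) (Fin n) ℂ
    !![0, Dmat n, 0;
       -Dmat n, 0, (γ : ℂ) • Dmat n;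
       0, -((γ : ℂ) • Dmat n), -(Dmat n * Dmat n)]

/-- The modal approximation as an operator on `H_n`: the operator whose matrix in the basis
`E_1, …, E_{3n}` is `Wmat γ n`. -/
def W (γ : ℝ) (n : ℕ) : ModalSpace n →L[ℂ] ModalSpace n :=
  LinearMap.toContinuousLinearMap (Matrix.toLin (modalBasis n) (modalBasis n) (Wmat γ n))

/-- The semigroup `T_n(t) = exp (t W_n)` on `H_n`. -/
def T (γ : ℝ) (n : ℕ) (t : ℝ) : ModalSpace n →L[ℂ] ModalSpace n :=
  NormedSpace.exp ((t : ℂ) • W γ n)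

end Thermo

end

namespace Thermo

/-! ### Semigroups generated by dissipative bounded operators -/

section Abstract

variable {E : Type*} [NormedAddCommGroup E] [InnerProductSpace ℂ E]

/-! The energy is dissipated only through the temperature, but the coupling passes this damping on
to velocity and displacement at a rate independent of `n`. A Lyapunov operator `P` makes this
quantitative: it is selfadjoint, nonnegative, bounded by `K`, and satisfies `Re ⟨Px, Ax⟩ ≤ -ω‖x‖²`,
with `ω` and `K` depending on `γ` alone.

Such a `P` gives everything. Along an orbit `f`, the quantity `Re ⟨Pf, f⟩ + 2ωt‖f‖²` decreases, so
`‖T(t)‖ ≤ √(K/2ω)/√t`. Since `⟨Px, x⟩` is real, testing `(iβ - A)x` against `Px` removes `iβ` and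
bounds the resolvent by `K/ω` on the whole imaginary axis; `β = 0` bounds the inverse. This is
stronger than required: neither the inverse in the decay estimate nor the factor `|β|⁻²` is needed.

`P` is a large multiple of the identity plus velocity–temperature and velocity–displacement
couplings scaled by `(2D)⁻¹`. The scaling keeps `P` bounded and compensates the frequency factor of
the generator. Everything splits into 3×3 real blocks, and `mode_decay` is the inequality for one
block. -/

theorem hasDerivAt_exp_smul_apply [CompleteSpace E] (A : E →L[ℂ] E) (x : E) (t : ℝ) :
    HasDerivAt (fun s : ℝ => NormedSpace.exp ((s : ℂ) • A) x)
      (A (NormedSpace.exp ((t : ℂ) • A) x)) t := by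
  have h := (hasDerivAt_exp_smul_const' (𝕂 := ℂ) A (t : ℂ)).scomp t Complex.ofRealCLM.hasDerivAt
  simp only [Complex.ofRealCLM_apply, Complex.ofReal_one, one_smul] at h
  have h2 := ((ContinuousLinearMap.apply ℂ E x).restrictScalars ℝ).hasFDerivAt.comp_hasDerivAt t h
  exact h2

theorem hasDerivAt_re_inner_apply {P : E →L[ℂ] E}
    (hP : ∀ x y, inner ℂ (P x) y = inner ℂ x (P y)) {f : ℝ → E} {f' : E} {t : ℝ}
    (hf : HasDerivAt f f' t) :
    HasDerivAt (fun s => (inner ℂ (P (f s)) (f s)).re) (2 * (inner ℂ (P (f t)) f').re) t := by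
  have h1 : HasDerivAt (fun s => P (f s)) (P f') t :=
    (P.restrictScalars ℝ).hasFDerivAt.comp_hasDerivAt t hf
  have h2 := Complex.reCLM.hasFDerivAt.comp_hasDerivAt t (h1.inner ℂ hf)
  refine h2.congr_deriv ?_
  have h3 : (inner ℂ (P f') (f t)).re = (inner ℂ (P (f t)) f').re := by
    rw [hP]; exact inner_re_symm (𝕜 := ℂ) _ _
  simp only [Complex.reCLM_apply, Complex.add_re, h3]
  ring

theorem hasDerivAt_norm_sq {f : ℝ → E} {f' : E} {t : ℝ} (hf : HasDerivAt f f' t) :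
    HasDerivAt (fun s => ‖f s‖ ^ 2) (2 * (inner ℂ (f t) f').re) t := by
  have h := hasDerivAt_re_inner_apply (P := ContinuousLinearMap.id ℂ E) (fun _ _ => rfl) hf
  refine h.congr_of_eventuallyEq (Filter.Eventually.of_forall fun s => ?_)
  exact (inner_self_eq_norm_sq (𝕜 := ℂ) (f s)).symm

/-- A dissipative bounded operator generates a contraction semigroup. -/
theorem norm_exp_smul_apply_le [CompleteSpace E] {A : E →L[ℂ] E}
    (hA : ∀ x, (inner ℂ x (A x)).re ≤ 0) {t : ℝ} (ht : 0 ≤ t) (x : E) :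
    ‖NormedSpace.exp ((t : ℂ) • A) x‖ ≤ ‖x‖ := by
  have hd := fun s => hasDerivAt_norm_sq (hasDerivAt_exp_smul_apply A x s)
  have hanti : Antitone fun s : ℝ => ‖NormedSpace.exp ((s : ℂ) • A) x‖ ^ 2 :=
    antitone_of_deriv_nonpos (fun s => (hd s).differentiableAt) fun s => by
      rw [(hd s).deriv]
      linarith [hA (NormedSpace.exp ((s : ℂ) • A) x)]
  have h := hanti ht
  simp only [Complex.ofReal_zero, zero_smul, NormedSpace.exp_zero,
    one_apply_eq_self] at h
  exact le_of_sq_le_sq h (norm_nonneg x)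

theorem isContractionSemigroup_exp [CompleteSpace E] {A : E →L[ℂ] E}
    (hA : ∀ x, (inner ℂ x (A x)).re ≤ 0) :
    IsContractionSemigroup fun t : ℝ => NormedSpace.exp ((t : ℂ) • A) where
  map_zero := by simp
  map_add s t _ _ := by
    let _ : NormedAlgebra ℚ (E →L[ℂ] E) := NormedAlgebra.restrictScalars ℚ ℂ _
    rw [Complex.ofReal_add, add_smul]
    exact NormedSpace.exp_add_of_commute (((Commute.refl A).smul_left _).smul_right _)
  continuousOn z := fun t _ => (hasDerivAt_exp_smul_apply A z t).continuousAt.continuousWithinAt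
  contraction t ht := ContinuousLinearMap.opNorm_le_bound _ zero_le_one fun x => by
    simpa using norm_exp_smul_apply_le hA ht x

theorem isGenerator_exp [CompleteSpace E] (A : E →L[ℂ] E) :
    IsGenerator (fun t : ℝ => NormedSpace.exp ((t : ℂ) • A)) A := fun z => by
  simpa using (hasDerivAt_exp_smul_apply A z 0).hasDerivWithinAt (s := Set.Ici 0)

/-! ### Consequences of a Lyapunov operator -/

/-- `P` is a Lyapunov operator for the dissipative operator `A`, with decay rate `ω` and norm
bound `K`. -/
structure IsLyapunov (A P : E →L[ℂ] E) (ω K : ℝ) : Prop where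
  pos : 0 < ω
  bound_nonneg : 0 ≤ K
  dissipative : ∀ x, (inner ℂ x (A x)).re ≤ 0
  symm : ∀ x y, inner ℂ (P x) y = inner ℂ x (P y)
  nonneg : ∀ x, 0 ≤ (inner ℂ (P x) x).re
  bound : ∀ x, ‖P x‖ ≤ K * ‖x‖
  decay : ∀ x, (inner ℂ (P x) (A x)).re ≤ -ω * ‖x‖ ^ 2

namespace IsLyapunov

variable {A P : E →L[ℂ] E} {ω K : ℝ}

/-- The decay of the Lyapunov form pays for the term `2ω‖f‖²` produced by differentiating the weight
`t`; the remaining term is nonpositive by dissipativity. Only nonnegativity of `P` is needed, not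
coercivity. -/
theorem norm_sq_exp_smul_apply_le [CompleteSpace E] (h : IsLyapunov A P ω K) {t : ℝ}
    (ht : 0 ≤ t) (x : E) :
    2 * ω * t * ‖NormedSpace.exp ((t : ℂ) • A) x‖ ^ 2 ≤ K * ‖x‖ ^ 2 := by
  set f : ℝ → E := fun s => NormedSpace.exp ((s : ℂ) • A) x with hf
  have hd : ∀ s, HasDerivAt
      (fun s => (inner ℂ (P (f s)) (f s)).re + 2 * ω * (s * ‖f s‖ ^ 2))
      (2 * (inner ℂ (P (f s)) (A (f s))).re +
        2 * ω * (1 * ‖f s‖ ^ 2 + s * (2 * (inner ℂ (f s) (A (f s))).re))) s := fun s =>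
    (hasDerivAt_re_inner_apply h.symm (hasDerivAt_exp_smul_apply A x s)).add
      (((hasDerivAt_id s).mul (hasDerivAt_norm_sq (hasDerivAt_exp_smul_apply A x s))).const_mul _)
  have hanti : AntitoneOn
      (fun s => (inner ℂ (P (f s)) (f s)).re + 2 * ω * (s * ‖f s‖ ^ 2)) (Set.Ici 0) :=
    antitoneOn_of_deriv_nonpos (convex_Ici 0)
      (fun s _ => (hd s).continuousAt.continuousWithinAt)
      (fun s _ => (hd s).differentiableAt.differentiableWithinAt) fun s hs => by
      rw [interior_Ici] at hs
      rw [(hd s).deriv]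
      have h1 := h.decay (f s)
      have h2 : ω * (s * (inner ℂ (f s) (A (f s))).re) ≤ 0 :=
        mul_nonpos_of_nonneg_of_nonpos h.pos.le
          (mul_nonpos_of_nonneg_of_nonpos (le_of_lt hs) (h.dissipative _))
      linarith
  have h1 := hanti (Set.self_mem_Ici) (Set.mem_Ici.2 ht) ht
  have hf0 : f 0 = x := by simp [hf]
  simp only [hf0, zero_mul, mul_zero, add_zero] at h1
  have h2 : (inner ℂ (P x) x).re ≤ K * ‖x‖ ^ 2 :=
    calc (inner ℂ (P x) x).re ≤ ‖P x‖ * ‖x‖ := re_inner_le_norm (𝕜 := ℂ) _ _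
      _ ≤ K * ‖x‖ * ‖x‖ := by gcongr; exact h.bound x
      _ = K * ‖x‖ ^ 2 := by ring
  have h3 := h.nonneg (f t)
  calc 2 * ω * t * ‖f t‖ ^ 2 = 2 * ω * (t * ‖f t‖ ^ 2) := by ring
    _ ≤ K * ‖x‖ ^ 2 := by linarith

theorem norm_exp_smul_le [CompleteSpace E] (h : IsLyapunov A P ω K) {t : ℝ} (ht : 0 < t) :
    ‖NormedSpace.exp ((t : ℂ) • A)‖ ≤ √(K / (2 * ω)) / √t := by
  refine ContinuousLinearMap.opNorm_le_bound _ (by positivity) fun x => ?_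
  have hω := h.pos
  have h1 := h.norm_sq_exp_smul_apply_le ht.le x
  refine le_of_sq_le_sq ?_ (by positivity)
  rw [mul_pow, div_pow, Real.sq_sqrt (div_nonneg h.bound_nonneg (by positivity)),
    Real.sq_sqrt ht.le, div_div, div_mul_eq_mul_div, le_div_iff₀ (by positivity)]
  linarith

theorem norm_le_mul_norm_sub (h : IsLyapunov A P ω K) (β : ℝ) (x : E) :
    ‖x‖ ≤ K / ω * ‖(Complex.I * (β : ℂ)) • x - A x‖ := by
  rcases eq_or_ne x 0 with rfl | hx
  · simp
  have hx' : 0 < ‖x‖ := norm_pos_iff.2 hx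
  -- Symmetry makes the form real, so the term in `iβ` is purely imaginary and drops out of the real
  -- part.
  have him : (inner ℂ (P x) x).im = 0 := by
    rw [← Complex.conj_eq_iff_im, inner_conj_symm, h.symm]
  have h0 : (inner ℂ (P x) ((Complex.I * (β : ℂ)) • x)).re = 0 := by
    rw [inner_smul_right, Complex.mul_re, him]
    simp
  have h1 : ω * ‖x‖ ^ 2 ≤ K * ‖x‖ * ‖(Complex.I * (β : ℂ)) • x - A x‖ :=
    calc ω * ‖x‖ ^ 2 ≤ (inner ℂ (P x) ((Complex.I * (β : ℂ)) • x - A x)).re := by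
          rw [inner_sub_right, Complex.sub_re, h0]
          linarith [h.decay x]
      _ ≤ ‖P x‖ * ‖(Complex.I * (β : ℂ)) • x - A x‖ := re_inner_le_norm (𝕜 := ℂ) _ _
      _ ≤ _ := by gcongr; exact h.bound x
  rw [div_mul_eq_mul_div, le_div_iff₀ h.pos]
  refine le_of_mul_le_mul_right ?_ hx'
  linarith

theorem isUnit_sub [FiniteDimensional ℂ E] (h : IsLyapunov A P ω K) (β : ℝ) :
    IsUnit (algebraMap ℂ (E →L[ℂ] E) (Complex.I * (β : ℂ)) - A) := by
  have : CompleteSpace E := FiniteDimensional.complete ℂ E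
  have hinj : Function.Injective (algebraMap ℂ (E →L[ℂ] E) (Complex.I * (β : ℂ)) - A) := by
    rw [injective_iff_map_eq_zero]
    intro x hx
    have h1 := h.norm_le_mul_norm_sub β x
    have h2 : (Complex.I * (β : ℂ)) • x - A x = 0 := hx
    rw [h2, norm_zero, mul_zero] at h1
    exact norm_le_zero_iff.1 h1
  rw [ContinuousLinearMap.isUnit_iff_bijective]
  exact ⟨hinj, LinearMap.surjective_of_injective
    (f := (algebraMap ℂ (E →L[ℂ] E) (Complex.I * (β : ℂ)) - A).toLinearMap) hinj⟩

theorem norm_inverse_sub_le [FiniteDimensional ℂ E] (h : IsLyapunov A P ω K) (β : ℝ) :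
    ‖Ring.inverse (algebraMap ℂ (E →L[ℂ] E) (Complex.I * (β : ℂ)) - A)‖ ≤ K / ω := by
  refine ContinuousLinearMap.opNorm_le_bound _ (div_nonneg h.bound_nonneg h.pos.le) fun y => ?_
  refine (h.norm_le_mul_norm_sub β _).trans_eq ?_
  congr 2
  exact congrArg (fun B : E →L[ℂ] E => B y) (Ring.mul_inverse_cancel _ (h.isUnit_sub β))

theorem isUnit [FiniteDimensional ℂ E] (h : IsLyapunov A P ω K) : IsUnit A := by
  simpa using (h.isUnit_sub 0).neg

theorem norm_inverse_le [FiniteDimensional ℂ E] (h : IsLyapunov A P ω K) :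
    ‖Ring.inverse A‖ ≤ K / ω := by
  refine ContinuousLinearMap.opNorm_le_bound _ (div_nonneg h.bound_nonneg h.pos.le) fun y => ?_
  refine (h.norm_le_mul_norm_sub 0 _).trans_eq ?_
  have hy : A (Ring.inverse A y) = y :=
    congrArg (fun B : E →L[ℂ] E => B y) (Ring.mul_inverse_cancel _ h.isUnit)
  simp [hy]

theorem norm_exp_mul_inverse_le [FiniteDimensional ℂ E] (h : IsLyapunov A P ω K) {t : ℝ}
    (ht : 0 < t) :
    ‖NormedSpace.exp ((t : ℂ) • A) * Ring.inverse A‖ ≤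
      √(K / (2 * ω)) * (K / ω) / t ^ (1 / 2 : ℝ) := by
  have : CompleteSpace E := FiniteDimensional.complete ℂ E
  rw [← Real.sqrt_eq_rpow, mul_div_right_comm]
  exact (norm_mul_le _ _).trans
    (mul_le_mul (h.norm_exp_smul_le ht) h.norm_inverse_le (norm_nonneg _) (by positivity))

end IsLyapunov

end Abstract


/-! ### Modal coordinates -/

section Modal

theorem inner_modalSpace (n : ℕ) (x y : ModalSpace n) :
    inner ℂ x y = ∑ j, (starRingEnd ℂ ((modalBasis n).repr x (0, j)) * (modalBasis n).repr y (0, j)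
      + starRingEnd ℂ ((modalBasis n).repr x (1, j)) * (modalBasis n).repr y (1, j)
      + starRingEnd ℂ ((modalBasis n).repr x (2, j)) * (modalBasis n).repr y (2, j)) := by
  have ho : Orthonormal ℂ (modalBasis n) := by
    rw [orthonormal_iff_ite]
    intro p q
    have hli := (orthonormal_modeVec n).linearIndependent
    exact (congrArg₂ (inner ℂ) (Module.Basis.span_apply hli p) (Module.Basis.span_apply hli q)).trans
      (orthonormal_iff_ite.1 (orthonormal_modeVec n) p q)
  rw [← ((modalBasis n).toOrthonormalBasis ho).repr.inner_map_map x y, PiLp.inner_apply,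
    Fintype.sum_prod_type, Fin.sum_univ_three, ← Finset.sum_add_distrib, ← Finset.sum_add_distrib]
  refine Finset.sum_congr rfl fun j _ => ?_
  simp [mul_comm]

theorem norm_sq_modalSpace (n : ℕ) (x : ModalSpace n) :
    ‖x‖ ^ 2 = ∑ j, (Complex.normSq ((modalBasis n).repr x (0, j))
      + Complex.normSq ((modalBasis n).repr x (1, j))
      + Complex.normSq ((modalBasis n).repr x (2, j))) := by
  rw [← inner_self_eq_norm_sq (𝕜 := ℂ) x, inner_modalSpace]
  simp [Complex.normSq_apply]

theorem comp_mulVec_apply {n : ℕ} (B : Matrix (Fin 3) (Fin 3) (Matrix (Fin n) (Fin n) ℂ))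
    (v : Fin 3 × Fin n → ℂ) (k : Fin 3) (j : Fin n) :
    (Matrix.comp (Fin 3) (Fin 3) (Fin n) (Fin n) ℂ B *ᵥ v) (k, j) =
      (B k 0 *ᵥ fun i => v (0, i)) j + (B k 1 *ᵥ fun i => v (1, i)) j
        + (B k 2 *ᵥ fun i => v (2, i)) j := by
  simp only [Matrix.mulVec, dotProduct, Fintype.sum_prod_type, Fin.sum_univ_three,
    Matrix.comp_apply]

theorem repr_W (γ : ℝ) (n : ℕ) (x : ModalSpace n) (j : Fin n) :
    (modalBasis n).repr (W γ n x) (0, j) = ((j : ℝ) + 1 : ℝ) * (modalBasis n).repr x (1, j) ∧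
    (modalBasis n).repr (W γ n x) (1, j) = -((j : ℝ) + 1 : ℝ) * (modalBasis n).repr x (0, j)
      + γ * ((j : ℝ) + 1 : ℝ) * (modalBasis n).repr x (2, j) ∧
    (modalBasis n).repr (W γ n x) (2, j) = -γ * ((j : ℝ) + 1 : ℝ) * (modalBasis n).repr x (1, j)
      - ((j : ℝ) + 1 : ℝ) ^ 2 * (modalBasis n).repr x (2, j) := by
  have h : ∀ p, (modalBasis n).repr (W γ n x) p = (Wmat γ n *ᵥ (modalBasis n).repr x) p :=
    fun p => congrFun (Matrix.repr_toLin _ _ _ _) p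
  set v : Fin 3 × Fin n → ℂ := ⇑((modalBasis n).repr x)
  have e0 : (Wmat γ n *ᵥ v) (0, j) = ((0 : Matrix (Fin n) (Fin n) ℂ) *ᵥ fun i => v (0, i)) j
      + (Dmat n *ᵥ fun i => v (1, i)) j
      + ((0 : Matrix (Fin n) (Fin n) ℂ) *ᵥ fun i => v (2, i)) j := comp_mulVec_apply _ _ _ _
  have e1 : (Wmat γ n *ᵥ v) (1, j) = ((-Dmat n) *ᵥ fun i => v (0, i)) j
      + ((0 : Matrix (Fin n) (Fin n) ℂ) *ᵥ fun i => v (1, i)) j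
      + (((γ : ℂ) • Dmat n) *ᵥ fun i => v (2, i)) j := comp_mulVec_apply _ _ _ _
  have e2 : (Wmat γ n *ᵥ v) (2, j) = ((0 : Matrix (Fin n) (Fin n) ℂ) *ᵥ fun i => v (0, i)) j
      + ((-((γ : ℂ) • Dmat n)) *ᵥ fun i => v (1, i)) j
      + ((-(Dmat n * Dmat n)) *ᵥ fun i => v (2, i)) j := comp_mulVec_apply _ _ _ _
  rw [h, h, h, e0, e1, e2]
  simp only [Matrix.zero_mulVec, Matrix.neg_mulVec, Matrix.smul_mulVec, Dmat,
    Matrix.diagonal_mul_diagonal, Matrix.mulVec_diagonal, Pi.neg_apply, Pi.smul_apply,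
    Pi.zero_apply, smul_eq_mul]
  push_cast
  refine ⟨?_, ?_, ?_⟩ <;> ring

/-! ### The Lyapunov operator in modal coordinates -/

/-- The coefficient `2 + 2γ² + γ⁴` of the energy in the Lyapunov form. -/
noncomputable def lyapunovWeight (γ : ℝ) : ℝ := 2 + 2 * γ ^ 2 + γ ^ 4

/-- The matrix `(2 D_n)⁻¹`. -/
noncomputable def halfInvMat (n : ℕ) : Matrix (Fin n) (Fin n) ℂ :=
  Matrix.diagonal fun j => ((1 / (2 * ((j : ℝ) + 1)) : ℝ) : ℂ)

/-- The matrix of the Lyapunov operator: a multiple of the identity, plus couplings between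
velocity and displacement and between velocity and temperature, damped by `D_n⁻¹`. -/
noncomputable def lyapunovMat (γ : ℝ) (n : ℕ) : Matrix (Fin 3 × Fin n) (Fin 3 × Fin n) ℂ :=
  Matrix.comp (Fin 3) (Fin 3) (Fin n) (Fin n) ℂ
    !![Matrix.diagonal fun _ => (lyapunovWeight γ : ℂ), (γ ^ 2 / 4 : ℝ) • halfInvMat n, 0;
       (γ ^ 2 / 4 : ℝ) • halfInvMat n, Matrix.diagonal fun _ => (lyapunovWeight γ : ℂ),
        γ • halfInvMat n;
       0, γ • halfInvMat n, Matrix.diagonal fun _ => (lyapunovWeight γ : ℂ)]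

/-- The Lyapunov operator of the modal approximation. -/
noncomputable def lyapunovOp (γ : ℝ) (n : ℕ) : ModalSpace n →L[ℂ] ModalSpace n :=
  LinearMap.toContinuousLinearMap (Matrix.toLin (modalBasis n) (modalBasis n) (lyapunovMat γ n))

theorem repr_lyapunovOp (γ : ℝ) (n : ℕ) (x : ModalSpace n) (j : Fin n) :
    (modalBasis n).repr (lyapunovOp γ n x) (0, j) =
      lyapunovWeight γ * (modalBasis n).repr x (0, j)
      + (γ ^ 2 / 4 : ℝ) * (1 / (2 * ((j : ℝ) + 1)) : ℝ) * (modalBasis n).repr x (1, j) ∧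
    (modalBasis n).repr (lyapunovOp γ n x) (1, j) =
      (γ ^ 2 / 4 : ℝ) * (1 / (2 * ((j : ℝ) + 1)) : ℝ) * (modalBasis n).repr x (0, j)
      + lyapunovWeight γ * (modalBasis n).repr x (1, j)
      + γ * (1 / (2 * ((j : ℝ) + 1)) : ℝ) * (modalBasis n).repr x (2, j) ∧
    (modalBasis n).repr (lyapunovOp γ n x) (2, j) =
      γ * (1 / (2 * ((j : ℝ) + 1)) : ℝ) * (modalBasis n).repr x (1, j)
      + lyapunovWeight γ * (modalBasis n).repr x (2, j) := by
  have h : ∀ p, (modalBasis n).repr (lyapunovOp γ n x) p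
      = (lyapunovMat γ n *ᵥ (modalBasis n).repr x) p :=
    fun p => congrFun (Matrix.repr_toLin _ _ _ _) p
  set v : Fin 3 × Fin n → ℂ := ⇑((modalBasis n).repr x)
  have e0 : (lyapunovMat γ n *ᵥ v) (0, j) =
      ((Matrix.diagonal fun _ => (lyapunovWeight γ : ℂ)) *ᵥ fun i => v (0, i)) j
      + (((γ ^ 2 / 4 : ℝ) • halfInvMat n) *ᵥ fun i => v (1, i)) j
      + ((0 : Matrix (Fin n) (Fin n) ℂ) *ᵥ fun i => v (2, i)) j := comp_mulVec_apply _ _ _ _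
  have e1 : (lyapunovMat γ n *ᵥ v) (1, j) =
      (((γ ^ 2 / 4 : ℝ) • halfInvMat n) *ᵥ fun i => v (0, i)) j
      + ((Matrix.diagonal fun _ => (lyapunovWeight γ : ℂ)) *ᵥ fun i => v (1, i)) j
      + ((γ • halfInvMat n) *ᵥ fun i => v (2, i)) j := comp_mulVec_apply _ _ _ _
  have e2 : (lyapunovMat γ n *ᵥ v) (2, j) =
      ((0 : Matrix (Fin n) (Fin n) ℂ) *ᵥ fun i => v (0, i)) j
      + ((γ • halfInvMat n) *ᵥ fun i => v (1, i)) j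
      + ((Matrix.diagonal fun _ => (lyapunovWeight γ : ℂ)) *ᵥ fun i => v (2, i)) j :=
    comp_mulVec_apply _ _ _ _
  rw [h, h, h, e0, e1, e2]
  simp only [Matrix.zero_mulVec, Matrix.smul_mulVec, halfInvMat, Matrix.mulVec_diagonal,
    Pi.smul_apply, Pi.zero_apply, Complex.real_smul]
  refine ⟨?_, ?_, ?_⟩ <;> ring

/-! ### Inequalities for a single real mode -/

/-- The decay of the Lyapunov form along a single real mode. -/
theorem mode_decay (γ a b c : ℝ) {d r : ℝ} (hd : 1 ≤ d) (hr : r * d = 1 / 2) :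
    (lyapunovWeight γ * a + γ ^ 2 / 4 * r * b) * (d * b)
      + (γ ^ 2 / 4 * r * a + lyapunovWeight γ * b + γ * r * c) * (-d * a + γ * d * c)
      + (γ * r * b + lyapunovWeight γ * c) * (-γ * d * b - d ^ 2 * c)
      ≤ -(γ ^ 2 / 16) * (a ^ 2 + b ^ 2 + c ^ 2) := by
  -- With `r * d = 1 / 2`, the velocity–temperature coupling yields `-γ²b²/2` and the
  -- velocity–displacement one `-γ²a²/8`. The latter costs `γ²b²/8`, which the former absorbs thanks
  -- to the factor `1/4` in the coupling.
  have key : (lyapunovWeight γ * a + γ ^ 2 / 4 * r * b) * (d * b)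
      + (γ ^ 2 / 4 * r * a + lyapunovWeight γ * b + γ * r * c) * (-d * a + γ * d * c)
      + (γ * r * b + lyapunovWeight γ * c) * (-γ * d * b - d ^ 2 * c)
      = -lyapunovWeight γ * (d * c) ^ 2 + γ ^ 2 / 8 * b ^ 2 - γ ^ 2 / 8 * a ^ 2
        - γ / 2 * (1 - γ ^ 2 / 4) * (a * c) + γ ^ 2 / 2 * c ^ 2 - γ ^ 2 / 2 * b ^ 2
        - γ / 2 * (b * (d * c)) := by
    linear_combination (γ ^ 2 / 4 * (b ^ 2 - a ^ 2) + γ ^ 3 / 4 * (a * c) - γ * (a * c)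
      + γ ^ 2 * c ^ 2 - γ ^ 2 * b ^ 2 - γ * d * (b * c)) * hr
  rw [key]
  have hdc : c ^ 2 ≤ (d * c) ^ 2 := by
    rw [mul_pow]
    exact le_mul_of_one_le_left (sq_nonneg c) (one_le_pow₀ hd)
  -- Half of this square absorbs the cross term in `b * (d * c)`, the next square the one in `a *
  -- c`. The latter leaves exactly `-γ²a²/16`, hence the rate; `b²` keeps the larger margin `γ²/4`.
  have h1 : 0 ≤ (γ * b / 2 + d * c) ^ 2 := sq_nonneg _
  have h2 : 0 ≤ (γ * a / 4 + (1 - γ ^ 2 / 4) * c) ^ 2 := sq_nonneg _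
  have h3 : (γ ^ 2 / 2 + γ ^ 2 / 16 + (1 - γ ^ 2 / 4) ^ 2) * c ^ 2 ≤
      (γ ^ 2 / 2 + γ ^ 2 / 16 + (1 - γ ^ 2 / 4) ^ 2) * (d * c) ^ 2 :=
    mul_le_mul_of_nonneg_left hdc (by positivity)
  -- The weight is chosen to dominate all the temperature terms, once `c²` is replaced by `(dc)²`.
  have h4 : 0 ≤ (lyapunovWeight γ - 1 / 2 - γ ^ 2 / 2 - γ ^ 2 / 16 - (1 - γ ^ 2 / 4) ^ 2)
      * (d * c) ^ 2 := by
    refine mul_nonneg ?_ (sq_nonneg _)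
    unfold lyapunovWeight
    nlinarith [sq_nonneg γ, sq_nonneg (γ ^ 2)]
  nlinarith [mul_nonneg (sq_nonneg γ) (sq_nonneg b)]

theorem mode_nonneg (γ a b c : ℝ) {r : ℝ} (hr : 0 ≤ r) (hr1 : r ≤ 1 / 2) :
    0 ≤ (lyapunovWeight γ * a + γ ^ 2 / 4 * r * b) * a
      + (γ ^ 2 / 4 * r * a + lyapunovWeight γ * b + γ * r * c) * b
      + (γ * r * b + lyapunovWeight γ * c) * c := by
  have h1 : 0 ≤ r * (γ ^ 2 / 4 * (a + b) ^ 2 + (γ * b + c) ^ 2) := by positivity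
  have h2 : r * (γ ^ 2 / 4 * (a ^ 2 + b ^ 2) + (γ ^ 2 * b ^ 2 + c ^ 2)) ≤
      1 / 2 * (γ ^ 2 / 4 * (a ^ 2 + b ^ 2) + (γ ^ 2 * b ^ 2 + c ^ 2)) :=
    mul_le_mul_of_nonneg_right hr1 (by positivity)
  have h3 : 0 ≤ (γ ^ 4 + γ ^ 2 + 1) * (a ^ 2 + b ^ 2 + c ^ 2) := by positivity
  have h4 : 0 ≤ γ ^ 2 * a ^ 2 := by positivity
  have h5 : 0 ≤ γ ^ 2 * b ^ 2 := by positivity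
  have h6 : 0 ≤ γ ^ 2 * c ^ 2 := by positivity
  unfold lyapunovWeight
  nlinarith [sq_nonneg a, sq_nonneg b, sq_nonneg c]

/-- Every entry of the 3×3 block is at most the weight in absolute value, so the block norm is at
most three times it. -/
theorem mode_bound (γ a b c : ℝ) {r : ℝ} (hr : 0 ≤ r) (hr1 : r ≤ 1 / 2) :
    (lyapunovWeight γ * a + γ ^ 2 / 4 * r * b) ^ 2
      + (γ ^ 2 / 4 * r * a + lyapunovWeight γ * b + γ * r * c) ^ 2
      + (γ * r * b + lyapunovWeight γ * c) ^ 2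
      ≤ (3 * lyapunovWeight γ) ^ 2 * (a ^ 2 + b ^ 2 + c ^ 2) := by
  set K := lyapunovWeight γ with hK
  have hs : (γ ^ 2 / 4 * r) ^ 2 ≤ K ^ 2 := by
    refine pow_le_pow_left₀ (by positivity) ?_ 2
    have : γ ^ 2 / 4 * r ≤ γ ^ 2 / 4 * (1 / 2) := by gcongr
    rw [hK]; unfold lyapunovWeight
    nlinarith [sq_nonneg γ, sq_nonneg (γ ^ 2)]
  have hq : (γ * r) ^ 2 ≤ K ^ 2 := by
    have h1 : γ ^ 2 * r ^ 2 ≤ γ ^ 2 * 1 := by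
      gcongr
      nlinarith
    rw [hK]; unfold lyapunovWeight
    nlinarith [sq_nonneg γ, sq_nonneg (γ ^ 2), sq_nonneg (γ ^ 3), sq_nonneg (γ ^ 4)]
  generalize γ ^ 2 / 4 * r = s at *
  generalize γ * r = q at *
  have ha := mul_le_mul_of_nonneg_right hs (sq_nonneg a)
  have hb := mul_le_mul_of_nonneg_right hs (sq_nonneg b)
  have hb' := mul_le_mul_of_nonneg_right hq (sq_nonneg b)
  have hc := mul_le_mul_of_nonneg_right hq (sq_nonneg c)
  have e1 : (K * a + s * b) ^ 2 ≤ 2 * (K ^ 2 * a ^ 2 + s ^ 2 * b ^ 2) := by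
    linarith [sq_nonneg (K * a - s * b)]
  have e2 : (s * a + K * b + q * c) ^ 2
      ≤ 3 * (s ^ 2 * a ^ 2 + K ^ 2 * b ^ 2 + q ^ 2 * c ^ 2) := by
    linarith [sq_nonneg (s * a - K * b), sq_nonneg (s * a - q * c), sq_nonneg (K * b - q * c)]
  have e3 : (q * b + K * c) ^ 2 ≤ 2 * (q ^ 2 * b ^ 2 + K ^ 2 * c ^ 2) := by
    linarith [sq_nonneg (q * b - K * c)]
  have := mul_nonneg (sq_nonneg K) (sq_nonneg a)
  have := mul_nonneg (sq_nonneg K) (sq_nonneg b)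
  have := mul_nonneg (sq_nonneg K) (sq_nonneg c)
  linarith

theorem lyapunovWeight_pos (γ : ℝ) : 0 < lyapunovWeight γ := by
  unfold lyapunovWeight; positivity

theorem isLyapunov_lyapunovOp {γ : ℝ} (hγ : γ ≠ 0) (n : ℕ) :
    IsLyapunov (W γ n) (lyapunovOp γ n) (γ ^ 2 / 16) (3 * lyapunovWeight γ) where
  pos := by positivity
  bound_nonneg := by linarith [lyapunovWeight_pos γ]
  dissipative x := by
    rw [inner_modalSpace, Complex.re_sum]
    refine Finset.sum_nonpos fun j _ => ?_
    obtain ⟨h0, h1, h2⟩ := repr_W γ n x j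
    rw [h0, h1, h2]
    generalize (modalBasis n).repr x (0, j) = a
    generalize (modalBasis n).repr x (1, j) = b
    generalize (modalBasis n).repr x (2, j) = c
    generalize (j : ℝ) + 1 = d
    simp [pow_two]
    nlinarith [sq_nonneg (d * c.re), sq_nonneg (d * c.im)]
  symm x y := by
    rw [inner_modalSpace, inner_modalSpace]
    refine Finset.sum_congr rfl fun j _ => ?_
    obtain ⟨h0, h1, h2⟩ := repr_lyapunovOp γ n x j
    obtain ⟨g0, g1, g2⟩ := repr_lyapunovOp γ n y j
    rw [h0, h1, h2, g0, g1, g2]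
    simp only [map_add, map_mul, Complex.conj_ofReal]
    ring
  nonneg x := by
    rw [inner_modalSpace, Complex.re_sum]
    refine Finset.sum_nonneg fun j _ => ?_
    obtain ⟨h0, h1, h2⟩ := repr_lyapunovOp γ n x j
    rw [h0, h1, h2]
    have hr : (0 : ℝ) ≤ 1 / (2 * ((j : ℝ) + 1)) := by positivity
    have hr1 : 1 / (2 * ((j : ℝ) + 1)) ≤ 1 / 2 :=
      one_div_le_one_div_of_le two_pos (by linarith [(Nat.cast_nonneg j : (0 : ℝ) ≤ (j : ℕ))])
    generalize (modalBasis n).repr x (0, j) = a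
    generalize (modalBasis n).repr x (1, j) = b
    generalize (modalBasis n).repr x (2, j) = c
    generalize 1 / (2 * ((j : ℝ) + 1)) = r at *
    have e1 := mode_nonneg γ a.re b.re c.re hr hr1
    have e2 := mode_nonneg γ a.im b.im c.im hr hr1
    -- The block has real coefficients, so real and imaginary parts separate.
    refine (add_nonneg e1 e2).trans_eq ?_
    simp only [Complex.add_re, Complex.add_im, Complex.mul_re, Complex.mul_im, Complex.conj_re,
      Complex.conj_im, Complex.ofReal_re, Complex.ofReal_im]
    ring
  bound x := by
    have hK := lyapunovWeight_pos γ
    refine le_of_sq_le_sq ?_ (by positivity)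
    rw [mul_pow, norm_sq_modalSpace, norm_sq_modalSpace, Finset.mul_sum]
    refine Finset.sum_le_sum fun j _ => ?_
    obtain ⟨h0, h1, h2⟩ := repr_lyapunovOp γ n x j
    rw [h0, h1, h2]
    have hr : (0 : ℝ) ≤ 1 / (2 * ((j : ℝ) + 1)) := by positivity
    have hr1 : 1 / (2 * ((j : ℝ) + 1)) ≤ 1 / 2 :=
      one_div_le_one_div_of_le two_pos (by linarith [(Nat.cast_nonneg j : (0 : ℝ) ≤ (j : ℕ))])
    generalize (modalBasis n).repr x (0, j) = a
    generalize (modalBasis n).repr x (1, j) = b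
    generalize (modalBasis n).repr x (2, j) = c
    generalize 1 / (2 * ((j : ℝ) + 1)) = r at *
    have e1 := mode_bound γ a.re b.re c.re hr hr1
    have e2 := mode_bound γ a.im b.im c.im hr hr1
    refine (Eq.trans_le ?_ (add_le_add e1 e2)).trans_eq ?_ <;>
    · simp only [Complex.normSq_apply, Complex.add_re, Complex.add_im, Complex.mul_re,
        Complex.mul_im, Complex.ofReal_re, Complex.ofReal_im]
      ring
  decay x := by
    rw [inner_modalSpace, Complex.re_sum, norm_sq_modalSpace, Finset.mul_sum]
    refine Finset.sum_le_sum fun j _ => ?_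
    obtain ⟨h0, h1, h2⟩ := repr_lyapunovOp γ n x j
    obtain ⟨g0, g1, g2⟩ := repr_W γ n x j
    rw [h0, h1, h2, g0, g1, g2]
    have hd : (1 : ℝ) ≤ (j : ℝ) + 1 := by linarith [(Nat.cast_nonneg j : (0 : ℝ) ≤ (j : ℕ))]
    have hr : 1 / (2 * ((j : ℝ) + 1)) * ((j : ℝ) + 1) = 1 / 2 := by field_simp
    generalize (modalBasis n).repr x (0, j) = a
    generalize (modalBasis n).repr x (1, j) = b
    generalize (modalBasis n).repr x (2, j) = c
    generalize 1 / (2 * ((j : ℝ) + 1)) = r at *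
    generalize (j : ℝ) + 1 = d at *
    have e1 := mode_decay γ a.re b.re c.re hd hr
    have e2 := mode_decay γ a.im b.im c.im hd hr
    refine (Eq.trans_le ?_ (add_le_add e1 e2)).trans_eq ?_ <;>
    · simp only [Complex.normSq_apply, Complex.add_re, Complex.add_im, Complex.sub_re,
        Complex.sub_im, Complex.neg_re, Complex.neg_im, Complex.mul_re,
        Complex.mul_im, Complex.conj_re, Complex.conj_im, Complex.ofReal_re, Complex.ofReal_im,
        pow_two]
      ring

end Modal

end Thermo

theorem theorem4p6 (γ : ℝ) (hγ : γ ≠ 0) :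
    (∀ n : ℕ, Thermo.IsContractionSemigroup (Thermo.T γ n) ∧
      Thermo.IsGenerator (Thermo.T γ n) (Thermo.W γ n)) ∧
    Thermo.UniformlyPolynomiallyStable (Thermo.T γ) (Thermo.W γ) 2 ∧
    (∃ M : ℝ, 0 < M ∧ ∀ (n : ℕ) (t : ℝ), 0 < t →
      ‖Thermo.T γ n t * Ring.inverse (Thermo.W γ n)‖ ≤ M / t ^ (1 / 2 : ℝ)) ∧
    (∀ (n : ℕ) (β : ℝ), Complex.I * (β : ℂ) ∈ resolventSet ℂ (Thermo.W γ n)) ∧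
    (∃ C : ℝ, ∀ (n : ℕ) (β : ℝ), 1 ≤ |β| →
      (|β| ^ 2)⁻¹ * ‖resolvent (Thermo.W γ n) (Complex.I * (β : ℂ))‖ ≤ C) := by
  have hL := Thermo.isLyapunov_lyapunovOp hγ
  have hK := Thermo.lyapunovWeight_pos γ
  have hM : ∃ M : ℝ, 0 < M ∧ ∀ (n : ℕ) (t : ℝ), 0 < t →
      ‖Thermo.T γ n t * Ring.inverse (Thermo.W γ n)‖ ≤ M / t ^ (1 / 2 : ℝ) :=
    ⟨_, by positivity, fun n t ht => (hL n).norm_exp_mul_inverse_le ht⟩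
  refine ⟨fun n => ?_, ⟨fun n => (hL n).isUnit, hM⟩, hM, fun n β => (hL n).isUnit_sub β,
    3 * Thermo.lyapunovWeight γ / (γ ^ 2 / 16), fun n β hβ => ?_⟩
  · have : CompleteSpace (Thermo.ModalSpace n) := FiniteDimensional.complete ℂ _
    exact ⟨Thermo.isContractionSemigroup_exp (hL n).dissipative, Thermo.isGenerator_exp _⟩
  · calc (|β| ^ 2)⁻¹ * ‖resolvent (Thermo.W γ n) (Complex.I * (β : ℂ))‖
        ≤ 1 * ‖resolvent (Thermo.W γ n) (Complex.I * (β : ℂ))‖ := by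
          gcongr
          -- The factor `|β|⁻²` is simply discarded: the resolvent itself is uniformly bounded.
          exact inv_le_one_of_one_le₀ (one_le_pow₀ hβ)
      _ ≤ _ := by
          rw [one_mul]
          exact (hL n).norm_inverse_sub_le β
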